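/- For a topological space $X$ let $x\le y$ mean that every open set containing $x$ contains $y$ (the specialization preorder), and for $U\subseteq X$ put $$\mathord{\downarrow}U=\{x\in X\mid x\le y\text{ for some }y\in U\},\qquad \mathord{\Uparrow}U=\{x\in X\mid y\in U\text{ for all }y\ge x\}.$$ Let $\mathsf{RO}(X)$ be the Boolean algebra of regular open subsets of $X$, and for $U,V\in\mathsf{RO}(X)$ write $U\ll V$ if $\overline U\subseteq\mathord{\downarrow}V$. For a proper filter $F$ on $\mathsf{RO}(X)$ let $F^{\circ}=\{V\in F\mid U\ll V\text{ for some }U\in F\}$; $F$ is called concordant if $F^{\circ}=F$. For $x\in X$ let $\mathsf{RO}(x)=\{U\in\mathsf{RO}(X)\mid x\in U\}$. A topological space $X$ is a *$dV$-space* (de Vries space) if: 1. $X$ is $T_0$, compact (every open cover has a finite subcover), and order-normal: whenever $A$ is closed, $B$ is regular closed and $A\cap\mathord{\Uparrow}B=\emptyset$, there are disjoint open sets $U,V$ with $A\subseteq\mathord{\downarrow}U$ and $\mathord{\Uparrow}B\subseteq V$; 2. $\mathsf{RO}(X)$ is a basis of the topology of $X$, and $\mathord{\Uparrow}\mathord{\downarrow}U=U$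 for every $U\in\mathsf{RO}(X)$; 3. for every $x\in X$, $\mathsf{RO}(x)$ is a concordant (proper) filter on $\mathsf{RO}(X)$, and for every proper filter $F$ on $\mathsf{RO}(X)$ there is $x\in X$ with $F^{\circ}=\mathsf{RO}(x)$. Let $L$ be a frame (locale), with pseudo-complement $\neg$. It is compact if every $S\subseteq L$ with $\bigvee S=1$ has a finite subset $T$ with $\bigvee T=1$; it is regular if $a=\bigvee\{b\in L\mid a\vee\neg b=1\}$ for every $a\in L$. The *upper Vietoris space* $UV(L)$ of a compact regular locale $L$ is the set $L\setminus\{1\}$ with the topology generated by the sets $\Box a=\{b\in L\setminus\{1\}\mid a\vee b=1\}$, $a\in L$. **Theorem.** A topological space is a $dV$-space if and only if it is homeomorphic to the upper Vietoris space of a compact regular locale. -/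

import Mathlib

open TopologicalSpace

universe u

section Spaces

variable {X : Type u} [TopologicalSpace X]

/-- The specialization preorder `x ≤ y`: every open set that contains `x` contains `y`. -/
def SpecLE (x y : X) : Prop :=
  ∀ U : Set X, IsOpen U → x ∈ U → y ∈ U

/-- The downset generated by `U` in the specialization preorder, that is, the closure of `U` in
the topology of all upward closed sets. -/
def downSet (U : Set X) : Set X :=
  {x | ∃ y ∈ U, SpecLE x y}

/-- The largest upward closed subset of `U` in the specialization preorder, that is, the interior
of `U` in the topology of all upward closed sets. -/
def upInterior (U : Set X) : Set X :=
  {x | ∀ y, SpecLE x y → y ∈ U}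

/-- `U` is order-regular open: it equals the interior of its closure in the topology of all
upward closed sets. -/
def IsOrderRegularOpen (U : Set X) : Prop :=
  upInterior (downSet U) = U

/-- `B` is regular closed: it is the closure of its interior. -/
def IsRegularClosed (B : Set X) : Prop :=
  closure (interior B) = B

variable (X)

/-- The Boolean algebra of regular open subsets of `X`. In the frame `Opens X` the pseudo-complement
of `U` is the complement of the closure of `U`, so the regular elements are the regular open sets. -/
abbrev RO : Type u := Heyting.Regular (Opens X)

/-- Order-normality. -/
def IsOrderNormal : Prop :=
  ∀ A B : Set X, IsClosed A → IsRegularClosed B → Disjoint A (upInterior B) →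
    ∃ U V : Set X, IsOpen U ∧ IsOpen V ∧ Disjoint U V ∧ A ⊆ downSet U ∧ upInterior B ⊆ V

variable {X}

/-- A regular open set, seen as a set of points. -/
def RO.toSet (U : RO X) : Set X := ((U : Opens X) : Set X)

/-- The relation `U ≪ V` on regular open sets: the closure of `U` lies in the downset of `V`. -/
def RO.WellBelow (U V : RO X) : Prop :=
  closure U.toSet ⊆ downSet V.toSet

/-- The set of the regular open sets that contain the point `x`. -/
def RO.nhd (x : X) : Set (RO X) :=
  {U | x ∈ U.toSet}

end Spaces

section Filters

variable {B : Type u} [BooleanAlgebra B]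

/-- Proper filters of a Boolean algebra. -/
def IsProperFilter (F : Set B) : Prop :=
  Order.IsPFilter F ∧ ⊥ ∉ F

/-- The elements `a` of `F` such that `b ≺ a` for some `b` in `F`. -/
def roundPart (prec : B → B → Prop) (F : Set B) : Set B :=
  {a | a ∈ F ∧ ∃ b ∈ F, prec b a}

/-- Concordant filters of a Boolean algebra with a relation `≺`. -/
def IsConcordantFilter (prec : B → B → Prop) (F : Set B) : Prop :=
  IsProperFilter F ∧ roundPart prec F = F

end Filters

/-- De Vries spaces (`dV`-spaces). -/
structure IsDVSpace (X : Type u) [TopologicalSpace X] : Prop where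
  t0 : T0Space X
  compact : CompactSpace X
  orderNormal : IsOrderNormal X
  basis : Opens.IsBasis {U : Opens X | Heyting.IsRegular U}
  orderRegular : ∀ U : RO X, IsOrderRegularOpen U.toSet
  concordant : ∀ x : X, IsConcordantFilter RO.WellBelow (RO.nhd x)
  realized : ∀ F : Set (RO X), IsProperFilter F → ∃ x : X, roundPart RO.WellBelow F = RO.nhd x

section Frames

variable {L : Type u} [Order.Frame L]

/-- `a` is rather below `b`; here `aᶜ` is the pseudo-complement of `a`. -/
def RatherBelow (a b : L) : Prop :=
  b ⊔ aᶜ = ⊤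

variable (L)

/-- Compact frames. -/
def IsCompactFrame : Prop :=
  ∀ S : Set L, sSup S = ⊤ → ∃ T ⊆ S, T.Finite ∧ sSup T = ⊤

/-- Regular frames: every element is the join of the elements rather below it. -/
def IsRegularFrame : Prop :=
  ∀ a : L, a = sSup {b | RatherBelow b a}

/-- The points of the upper Vietoris space of `L`: the elements of `L` other than the top. -/
def UpperVietoris : Type u := {b : L // b ≠ ⊤}

variable {L}

/-- The set `□ a` of all points `b` with `a ∨ b = 1`. -/
def UpperVietoris.box (a : L) : Set (UpperVietoris L) :=
  {b | a ⊔ b.1 = ⊤}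

/-- The topology generated by the sets `□ a`. -/
instance UpperVietoris.instTopologicalSpace : TopologicalSpace (UpperVietoris L) :=
  generateFrom (Set.range UpperVietoris.box)

end Frames


/-!
A point `x` of a `dV`-space `X` is determined by its concordant filter `RO.nhd x`, and every
concordant filter arises in this way; complementation in `RO X` turns these filters into the proper
round ideals of the proximity `≪`. The round ideals form a compact regular frame, and the join of a
round ideal `I` and the ideal of `x` is the top exactly if `x` lies in a member of `I`, so that `X`
is the upper Vietoris space of this frame.

Conversely, let `L` be a compact regular frame. The specialization preorder of its upper Vietoris
space is the order of `L`, and `□` identifies the regular elements of `L` with the regular open sets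
and the rather-below relation with `≪`. The axioms of a `dV`-space thereby become statements about
`L`; a proper filter `F` of regular elements is realized by the point `⋁ {¬b | b ∈ F}`.
-/
section Frames

variable {L : Type*} [Order.Frame L] {a b c : L}

theorem ratherBelow_iff_codisjoint : RatherBelow a b ↔ Codisjoint b aᶜ :=
  codisjoint_iff.symm

namespace RatherBelow

theorem le (h : RatherBelow a b) : a ≤ b :=
  disjoint_compl_right.le_of_codisjoint (ratherBelow_iff_codisjoint.1 h).symm

theorem bot_left (a : L) : RatherBelow ⊥ a := by
  simp only [RatherBelow, compl_bot, sup_top_eq]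

theorem sup (ha : RatherBelow a c) (hb : RatherBelow b c) : RatherBelow (a ⊔ b) c := by
  rw [ratherBelow_iff_codisjoint, compl_sup]
  exact (ratherBelow_iff_codisjoint.1 ha).inf_right (ratherBelow_iff_codisjoint.1 hb)

theorem compl_compl (h : RatherBelow a b) : RatherBelow aᶜᶜ b := by
  rwa [RatherBelow, compl_compl_compl]

end RatherBelow

theorem isCompactFrame_iff_isCompactElement_top :
    IsCompactFrame L ↔ IsCompactElement (⊤ : L) := by
  simp only [IsCompactFrame, top_le_iff,
    CompleteLattice.isCompactElement_iff_exists_le_sSup_of_le_sSup]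
  refine forall₂_congr fun S _ => ⟨?_, ?_⟩
  · rintro ⟨T, hTS, hT, hsup⟩
    exact ⟨hT.toFinset, by simpa using hTS, by simpa [Finset.sup_id_eq_sSup] using hsup⟩
  · rintro ⟨T, hTS, hsup⟩
    exact ⟨T, hTS, T.finite_toSet, by rwa [← Finset.sup_id_eq_sSup]⟩

theorem IsCompactFrame.exists_codisjoint_of_sSup (hc : IsCompactFrame L) {S : Set L}
    (hne : S.Nonempty) (hdir : DirectedOn (· ≤ ·) S) (h : Codisjoint (sSup S) a) :
    ∃ b ∈ S, Codisjoint b a := by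
  have htop : IsLUB ((· ⊔ a) '' S) ⊤ := by
    rw [isLUB_iff_sSup_eq, sSup_image, ← biSup_sup hne, ← sSup_eq_iSup, h.eq_top]
  have hdir' : DirectedOn (· ≤ ·) ((· ⊔ a) '' S) := by
    rintro _ ⟨b, hb, rfl⟩ _ ⟨c, hc, rfl⟩
    obtain ⟨d, hd, hbd, hcd⟩ := hdir b hb c hc
    exact ⟨_, ⟨d, hd, rfl⟩, sup_le_sup_right hbd a, sup_le_sup_right hcd a⟩
  obtain ⟨_, ⟨b, hb, rfl⟩, hba⟩ := isCompactFrame_iff_isCompactElement_top.1 hc _ _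
    (hne.image _) hdir' htop le_rfl
  exact ⟨b, hb, codisjoint_iff_le_sup.2 hba⟩

theorem IsRegularFrame.le_of_forall_ratherBelow_le (hr : IsRegularFrame L)
    (h : ∀ b, RatherBelow b a → b ≤ c) : a ≤ c :=
  (hr a).trans_le (sSup_le h)

theorem exists_ratherBelow_codisjoint (hc : IsCompactFrame L) (hr : IsRegularFrame L)
    (h : Codisjoint a c) : ∃ b, RatherBelow b a ∧ Codisjoint b c := by
  rw [hr a] at h
  exact hc.exists_codisjoint_of_sSup ⟨⊥, RatherBelow.bot_left a⟩
    (fun b hb d hd => ⟨b ⊔ d, RatherBelow.sup hb hd, le_sup_left, le_sup_right⟩) h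

end Frames

section ProperFilters

variable {B C : Type*} [BooleanAlgebra B] [BooleanAlgebra C] {F : Set B} {a b : B}

namespace IsProperFilter

theorem of_inf_mem (top : ⊤ ∈ F) (inf : ∀ a ∈ F, ∀ b ∈ F, a ⊓ b ∈ F)
    (upper : ∀ a b, a ≤ b → a ∈ F → b ∈ F) (bot : ⊥ ∉ F) : IsProperFilter F :=
  ⟨.of_def ⟨⊤, top⟩ (fun a ha b hb => ⟨a ⊓ b, inf a ha b hb, inf_le_left, inf_le_right⟩)
    (fun {a b} => upper a b), bot⟩

theorem top_mem (hF : IsProperFilter F) : ⊤ ∈ F :=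
  Order.PFilter.top_mem (F := hF.1.toPFilter)

theorem inf_mem (hF : IsProperFilter F) (ha : a ∈ F) (hb : b ∈ F) : a ⊓ b ∈ F :=
  Order.PFilter.inf_mem (F := hF.1.toPFilter) ha hb

theorem mem_of_le (hF : IsProperFilter F) (hab : a ≤ b) (ha : a ∈ F) : b ∈ F :=
  Order.PFilter.mem_of_le (F := hF.1.toPFilter) hab ha

theorem preimage {F : Set C} (hF : IsProperFilter F) (φ : B ≃o C) : IsProperFilter (φ ⁻¹' F) := by
  refine of_inf_mem ?_ (fun a ha b hb => ?_) (fun a b hab => hF.mem_of_le (φ.monotone hab)) ?_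
  · rw [Set.mem_preimage, map_top]
    exact hF.top_mem
  · rw [Set.mem_preimage, map_inf]
    exact hF.inf_mem ha hb
  · rw [Set.mem_preimage, map_bot]
    exact hF.2

end IsProperFilter

theorem roundPart_preimage {F : Set C} {prec : B → B → Prop} {prec' : C → C → Prop} (φ : B ≃o C)
    (hφ : ∀ a b, prec' (φ a) (φ b) ↔ prec a b) :
    roundPart prec (φ ⁻¹' F) = φ ⁻¹' roundPart prec' F := by
  ext a
  refine and_congr_right fun _ => ?_
  rw [φ.surjective.exists]
  simp only [Set.mem_preimage, hφ]

end ProperFilters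

section Ideals

variable {P : Type*} [DistribLattice P] [OrderBot P]

instance idealFrame : Order.Frame (Order.Ideal P) :=
  .ofMinimalAxioms
    { inf_sSup_le_iSup_inf := by
        rintro I S a ⟨haI, haS⟩
        let K : Order.Ideal P :=
          { carrier := {b | ∀ c ∈ I, c ⊓ b ∈ ⨆ J ∈ S, I ⊓ J}
            lower' b d hdb hb c hc := Order.Ideal.lower _ (inf_le_inf_left c hdb) (hb c hc)
            nonempty' := ⟨⊥, fun c _ => by rw [inf_bot_eq]; exact Order.Ideal.bot_mem _⟩
            directed' b hb d hd := ⟨b ⊔ d, fun c hc => by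
              rw [inf_sup_left]
              exact Order.Ideal.sup_mem (hb c hc) (hd c hc), le_sup_left, le_sup_right⟩ }
        have hSK : sSup S ≤ K := sSup_le fun J hJ b hb c hc =>
          le_iSup₂ (f := fun J (_ : J ∈ S) => I ⊓ J) J hJ
            ⟨I.lower inf_le_left hc, J.lower inf_le_right hb⟩
        simpa only [inf_idem] using hSK haS a haI }

end Ideals

/-- Interpolative proximity relations on a Boolean algebra: the axioms of a de Vries algebra other
than the approximation of an element by the elements below it. -/
structure Proximity (B : Type*) [BooleanAlgebra B] where
  /-- The relation `a ≺ b`. -/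
  rel : B → B → Prop
  bot_rel_bot : rel ⊥ ⊥
  le_of_rel {a b : B} : rel a b → a ≤ b
  rel_mono {a b c d : B} : a ≤ b → rel b c → c ≤ d → rel a d
  sup_rel {a b c : B} : rel a c → rel b c → rel (a ⊔ b) c
  compl_rel_compl {a b : B} : rel a b → rel bᶜ aᶜ
  exists_rel_rel {a b : B} : rel a b → ∃ c, rel a c ∧ rel c b

namespace Proximity

variable {B : Type*} [BooleanAlgebra B] (P : Proximity B) {a b c : B}

theorem top_rel_top : P.rel ⊤ ⊤ := by
  simpa only [compl_bot] using P.compl_rel_compl P.bot_rel_bot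

theorem rel_inf (hb : P.rel a b) (hc : P.rel a c) : P.rel a (b ⊓ c) := by
  simpa only [compl_sup, compl_compl] using
    P.compl_rel_compl (P.sup_rel (P.compl_rel_compl hb) (P.compl_rel_compl hc))

end Proximity

/-- The round ideals of a Boolean algebra with a proximity `≺`: every element `a` of the ideal is
`≺`-below another one. They form the compact regular frame dual to the de Vries algebra. -/
structure RoundIdeal {B : Type*} [BooleanAlgebra B] (P : Proximity B) extends Order.Ideal B where
  round : ∀ a ∈ carrier, ∃ b ∈ carrier, P.rel a b

namespace RoundIdeal

variable {B : Type*} [BooleanAlgebra B] {P : Proximity B} {I J : RoundIdeal P} {a b : B}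

theorem toIdeal_injective : Function.Injective (toIdeal : RoundIdeal P → Order.Ideal B) := by
  rintro ⟨I, _⟩ ⟨J, _⟩ rfl
  rfl

instance : SetLike (RoundIdeal P) B where
  coe I := I.toIdeal
  coe_injective := SetLike.coe_injective.comp toIdeal_injective

instance : PartialOrder (RoundIdeal P) := .ofSetLike (RoundIdeal P) B

variable (P) in
/-- The largest round ideal contained in an ideal. -/
def interior (I : Order.Ideal B) : RoundIdeal P where
  carrier := {a | ∃ b ∈ I, P.rel a b}
  lower' _ _ hca := fun ⟨b, hb, hab⟩ => ⟨b, hb, P.rel_mono hca hab le_rfl⟩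
  nonempty' := ⟨⊥, ⊥, I.bot_mem, P.bot_rel_bot⟩
  directed' := fun a ⟨b, hb, hab⟩ c ⟨d, hd, hcd⟩ =>
    ⟨a ⊔ c, ⟨b ⊔ d, Order.Ideal.sup_mem hb hd, P.sup_rel (P.rel_mono le_rfl hab le_sup_left)
      (P.rel_mono le_rfl hcd le_sup_right)⟩, le_sup_left, le_sup_right⟩
  round _ := fun ⟨b, hb, hab⟩ =>
    let ⟨c, hac, hcb⟩ := P.exists_rel_rel hab
    ⟨c, ⟨b, hb, hcb⟩, hac⟩

theorem interior_le (I : Order.Ideal B) : (interior P I).toIdeal ≤ I :=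
  fun _ ⟨_, hb, hab⟩ => I.lower (P.le_of_rel hab) hb

theorem gc_toIdeal_interior : GaloisConnection (toIdeal : RoundIdeal P → _) (interior P) :=
  fun I J => ⟨fun h a ha =>
    let ⟨b, hb, hab⟩ := I.round a ha
    ⟨b, h hb, hab⟩, fun h _ ha => interior_le J (h ha)⟩

/-- The inclusion of the round ideals into all ideals has the interior as its right adjoint, whence
joins of round ideals are computed as joins of ideals. -/
def gciInterior : GaloisCoinsertion (toIdeal : RoundIdeal P → _) (interior P) :=
  gc_toIdeal_interior.toGaloisCoinsertion fun I => interior_le I.toIdeal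

instance : CompleteLattice (RoundIdeal P) := gciInterior.liftCompleteLattice

theorem toIdeal_inf (I J : RoundIdeal P) : (I ⊓ J).toIdeal = I.toIdeal ⊓ J.toIdeal := by
  refine (interior_le _).antisymm fun a ⟨haI, haJ⟩ => ?_
  obtain ⟨b, hb, hab⟩ := I.round a haI
  obtain ⟨c, hc, hac⟩ := J.round a haJ
  exact ⟨b ⊓ c, ⟨I.lower inf_le_left hb, J.lower inf_le_right hc⟩, P.rel_inf hab hac⟩

theorem toIdeal_sup (I J : RoundIdeal P) : (I ⊔ J).toIdeal = I.toIdeal ⊔ J.toIdeal :=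
  GaloisConnection.l_sup (u := interior P) gc_toIdeal_interior

theorem toIdeal_sSup (S : Set (RoundIdeal P)) : (sSup S).toIdeal = ⨆ I ∈ S, I.toIdeal :=
  GaloisConnection.l_sSup (u := interior P) gc_toIdeal_interior

theorem toIdeal_iSup₂ {ι : Sort*} {κ : ι → Sort*} (I : ∀ i, κ i → RoundIdeal P) :
    (⨆ (i) (j), I i j).toIdeal = ⨆ (i) (j), (I i j).toIdeal :=
  GaloisConnection.l_iSup₂ (u := interior P) gc_toIdeal_interior

instance : Order.Frame (RoundIdeal P) :=
  .ofMinimalAxioms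
    { inf_sSup_le_iSup_inf I S := by
        change (I ⊓ sSup S).toIdeal ≤ (⨆ J ∈ S, I ⊓ J).toIdeal
        simp only [toIdeal_inf, toIdeal_sSup, toIdeal_iSup₂, inf_iSup₂_eq, le_refl] }

theorem mem_inf : a ∈ I ⊓ J ↔ a ∈ I ∧ a ∈ J := by
  change a ∈ (I ⊓ J).toIdeal ↔ _
  rw [toIdeal_inf]
  rfl

theorem mem_sup : a ∈ I ⊔ J ↔ ∃ b ∈ I, ∃ c ∈ J, a ≤ b ⊔ c := by
  change a ∈ (I ⊔ J).toIdeal ↔ _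
  rw [toIdeal_sup]
  rfl

theorem eq_top_iff_top_mem : I = ⊤ ↔ ⊤ ∈ I := by
  refine ⟨?_, fun h => top_le_iff.1 fun _ _ => I.lower le_top h⟩
  rintro rfl
  exact ⟨⊤, trivial, P.top_rel_top⟩

theorem codisjoint_iff : Codisjoint I J ↔ ∃ a ∈ I, aᶜ ∈ J := by
  rw [_root_.codisjoint_iff, eq_top_iff_top_mem, mem_sup]
  refine exists_congr fun a => and_congr_right fun _ =>
    ⟨?_, fun ha => ⟨aᶜ, ha, sup_compl_eq_top.ge⟩⟩
  rintro ⟨b, hb, hab⟩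
  exact J.lower (codisjoint_iff_compl_le_right.1 (codisjoint_iff_le_sup.2 hab)) hb

theorem mem_sSup_of_directedOn {S : Set (RoundIdeal P)} (hne : S.Nonempty)
    (hdir : DirectedOn (· ≤ ·) S) : a ∈ sSup S ↔ ∃ I ∈ S, a ∈ I := by
  refine ⟨fun ha => ?_, fun ⟨I, hI, ha⟩ => le_sSup hI ha⟩
  let U : RoundIdeal P :=
    { carrier := {a | ∃ I ∈ S, a ∈ I}
      lower' _ _ hba := fun ⟨I, hI, ha⟩ => ⟨I, hI, I.lower hba ha⟩
      nonempty' := let ⟨I, hI⟩ := hne; ⟨⊥, I, hI, I.bot_mem⟩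
      directed' a := fun ⟨I, hI, ha⟩ b ⟨J, hJ, hb⟩ =>
        let ⟨K, hK, hIK, hJK⟩ := hdir I hI J hJ
        ⟨a ⊔ b, ⟨K, hK, Order.Ideal.sup_mem (hIK ha) (hJK hb)⟩, le_sup_left, le_sup_right⟩
      round a := fun ⟨I, hI, ha⟩ =>
        let ⟨b, hb, hab⟩ := I.round a ha
        ⟨b, ⟨I, hI, hb⟩, hab⟩ }
  have hSU : sSup S ≤ U := sSup_le fun I hI b hb => ⟨I, hI, hb⟩
  exact hSU ha

theorem isCompactFrame : IsCompactFrame (RoundIdeal P) := by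
  refine isCompactFrame_iff_isCompactElement_top.2
    ((CompleteLattice.isCompactElement_iff_le_of_directed_sSup_le _ _).2 fun S hne hdir hS => ?_)
  rw [top_le_iff, eq_top_iff_top_mem, mem_sSup_of_directedOn hne hdir] at hS
  simpa only [top_le_iff, eq_top_iff_top_mem] using hS

variable (P) in
/-- The round ideal of the elements `a ≺ b`. -/
def below (b : B) : RoundIdeal P := interior P (.principal b)

theorem mem_below : a ∈ below P b ↔ P.rel a b :=
  ⟨fun ⟨_, hcb, hac⟩ => P.rel_mono le_rfl hac hcb, fun h => ⟨b, le_rfl, h⟩⟩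

theorem disjoint_below_compl (a : B) : Disjoint (below P a) (below P aᶜ) := by
  refine disjoint_iff_inf_le.2 fun b hb => ?_
  rw [mem_inf, mem_below, mem_below] at hb
  have hb' : b ≤ ⊥ := inf_compl_eq_bot (a := a) ▸ le_inf (P.le_of_rel hb.1) (P.le_of_rel hb.2)
  exact Order.Ideal.lower _ hb' (Order.Ideal.bot_mem _)

theorem ratherBelow_below (ha : a ∈ I) : RatherBelow (below P a) I := by
  obtain ⟨b, hb, hab⟩ := I.round a ha
  have hcompl : bᶜ ∈ (below P a)ᶜ :=
    (le_compl_iff_disjoint_left.2 (disjoint_below_compl a))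
      (mem_below.2 (P.compl_rel_compl hab))
  exact ratherBelow_iff_codisjoint.2 (codisjoint_iff.2 ⟨b, hb, hcompl⟩)

theorem isRegularFrame : IsRegularFrame (RoundIdeal P) := by
  refine fun I => le_antisymm (fun a ha => ?_) (sSup_le fun J hJ => hJ.le)
  obtain ⟨b, hb, hab⟩ := I.round a ha
  exact le_sSup (a := below P b) (ratherBelow_below hb) (mem_below.2 hab)

end RoundIdeal

section Specialization

variable {X : Type*} [TopologicalSpace X] {U V : Set X}

theorem specLE_iff_specializes {x y : X} : SpecLE x y ↔ y ⤳ x :=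
  specializes_iff_forall_open.symm

theorem subset_downSet (U : Set X) : U ⊆ downSet U :=
  fun x hx => ⟨x, hx, specLE_iff_specializes.2 specializes_rfl⟩

theorem downSet_mono (h : U ⊆ V) : downSet U ⊆ downSet V :=
  fun _ ⟨y, hy, hxy⟩ => ⟨y, h hy, hxy⟩

theorem upInterior_mono (h : U ⊆ V) : upInterior U ⊆ upInterior V :=
  fun _ hx y hxy => h (hx y hxy)

theorem upInterior_compl (U : Set X) : upInterior Uᶜ = (downSet U)ᶜ := by
  ext x
  simp only [upInterior, downSet, Set.mem_compl_iff, Set.mem_ofPred_eq, not_exists, not_and']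

theorem downSet_compl (U : Set X) : downSet Uᶜ = (upInterior U)ᶜ := by
  rw [← compl_compl (downSet _), ← upInterior_compl, compl_compl]

theorem subset_upInterior_of_isOpen (hU : IsOpen U) (h : U ⊆ V) : U ⊆ upInterior V :=
  fun _ hx _ hxy => h (hxy U hU hx)

end Specialization

section RegularOpens

variable {X : Type*} [TopologicalSpace X]

theorem coe_compl_opens (U : Opens X) : ((Uᶜ : Opens X) : Set X) = (closure (U : Set X))ᶜ := by
  rw [Opens.coe_compl_eq_interior_compl, interior_compl]

namespace RO

variable {x : X} {U U' V V' W : RO X}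

theorem isOpen_toSet (U : RO X) : IsOpen U.toSet := (U : Opens X).isOpen

theorem le_iff : U ≤ V ↔ U.toSet ⊆ V.toSet := Heyting.Regular.coe_le_coe.symm

theorem toSet_compl (U : RO X) : (Uᶜ).toSet = (closure U.toSet)ᶜ := by
  rw [toSet, Heyting.Regular.coe_compl, coe_compl_opens]
  rfl

theorem toSet_inf (U V : RO X) : (U ⊓ V).toSet = U.toSet ∩ V.toSet := by
  rw [toSet, Heyting.Regular.coe_inf]
  rfl

theorem toSet_toRegular (U : Opens X) :
    toSet (Heyting.Regular.toRegular U) = interior (closure (U : Set X)) := by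
  rw [toSet, Heyting.Regular.coe_toRegular, coe_compl_opens, coe_compl_opens, closure_compl,
    compl_compl]

theorem interior_closure_toSet (U : RO X) : interior (closure U.toSet) = U.toSet := by
  rw [toSet, ← toSet_toRegular, Heyting.Regular.toRegular_coe, toSet]

theorem closure_toSet_compl (U : RO X) : closure (Uᶜ).toSet = (U.toSet)ᶜ := by
  rw [toSet_compl, closure_compl, interior_closure_toSet]

theorem toSet_sup_subset (U V : RO X) : (U ⊔ V).toSet ⊆ closure U.toSet ∪ closure V.toSet := by
  rw [toSet, Heyting.Regular.coe_sup, coe_compl_opens, coe_compl_opens, closure_compl,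
    compl_compl, ← closure_union]
  exact interior_subset

theorem isRegularClosed_iff {B : Set X} : IsRegularClosed B ↔ ∃ U : RO X, (U.toSet)ᶜ = B := by
  constructor
  · intro hB
    have hBc : IsOpen Bᶜ := (hB ▸ isClosed_closure : IsClosed B).isOpen_compl
    refine ⟨Heyting.Regular.toRegular ⟨Bᶜ, hBc⟩, ?_⟩
    rw [toSet_toRegular, Opens.coe_mk, closure_compl, interior_compl, compl_compl, hB]
  · rintro ⟨U, rfl⟩
    rw [IsRegularClosed, interior_compl, closure_compl, interior_closure_toSet]

theorem isProperFilter_nhd (x : X) : IsProperFilter (nhd x) := by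
  refine .of_inf_mem (Set.mem_univ x) (fun U hU V hV => ?_) (fun U V h hU => le_iff.1 h hU)
    (Set.notMem_empty x)
  change x ∈ (U ⊓ V).toSet
  exact toSet_inf U V ▸ ⟨hU, hV⟩

theorem isConcordantFilter_nhd_iff :
    IsConcordantFilter WellBelow (nhd x) ↔ ∀ U ∈ nhd x, ∃ V ∈ nhd x, V.WellBelow U := by
  refine (and_iff_right (isProperFilter_nhd x)).trans ⟨fun h U hU => ?_, fun h => ?_⟩
  · exact (h.superset hU).2
  · exact Set.Subset.antisymm (fun U hU => hU.1) fun U hU => ⟨hU, h U hU⟩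

namespace WellBelow

theorem le (hV : IsOrderRegularOpen V.toSet) (h : U.WellBelow V) : U ≤ V :=
  le_iff.2 ((subset_upInterior_of_isOpen U.isOpen_toSet (subset_closure.trans h)).trans hV.subset)

theorem mono (hU : U' ≤ U) (h : U.WellBelow V) (hV : V ≤ V') : U'.WellBelow V' :=
  ((closure_mono (le_iff.1 hU)).trans h).trans (downSet_mono (le_iff.1 hV))

theorem sup (hU : U.WellBelow W) (hV : V.WellBelow W) : (U ⊔ V).WellBelow W :=
  (closure_minimal (toSet_sup_subset U V) (isClosed_closure.union isClosed_closure)).trans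
    (Set.union_subset hU hV)

theorem compl (hV : IsOrderRegularOpen V.toSet) (h : U.WellBelow V) : (Vᶜ).WellBelow Uᶜ := by
  rw [WellBelow, closure_toSet_compl, toSet_compl, downSet_compl, Set.compl_subset_compl]
  calc upInterior (closure U.toSet)
    _ ⊆ upInterior (downSet V.toSet) := upInterior_mono h
    _ ⊆ V.toSet := hV.subset

theorem exists_between (hn : IsOrderNormal X) (h : U.WellBelow V) :
    ∃ W, U.WellBelow W ∧ W.WellBelow V := by
  have hdisj : Disjoint (closure U.toSet) (upInterior (V.toSet)ᶜ) := by
    rwa [upInterior_compl, Set.disjoint_compl_right_iff_subset]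
  obtain ⟨P, Q, hP, hQ, hPQ, hUP, hVQ⟩ :=
    hn _ _ isClosed_closure (isRegularClosed_iff.2 ⟨V, rfl⟩) hdisj
  rw [upInterior_compl, Set.compl_subset_comm] at hVQ
  refine ⟨Heyting.Regular.toRegular ⟨P, hP⟩, hUP.trans (downSet_mono ?_), ?_⟩
  · rw [toSet_toRegular]
    exact hP.subset_interior_closure
  · have hPV : closure P ⊆ downSet V.toSet :=
      (closure_minimal hPQ.subset_compl_right hQ.isClosed_compl).trans hVQ
    rw [WellBelow, toSet_toRegular]
    exact (closure_minimal interior_subset isClosed_closure).trans hPV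

end WellBelow

end RO

end RegularOpens

namespace RoundIdeal

variable {B : Type*} [BooleanAlgebra B] {P : Proximity B} {F : Set B} {a : B}

/-- The round ideal of the complements of the elements of a concordant filter. -/
def ofConcordant (hF : IsConcordantFilter P.rel F) : RoundIdeal P where
  carrier := {a | aᶜ ∈ F}
  lower' _ _ hba ha := hF.1.mem_of_le (compl_le_compl hba) ha
  nonempty' := ⟨⊥, by simpa only [Set.mem_ofPred_eq, compl_bot] using hF.1.top_mem⟩
  directed' a ha b hb := ⟨a ⊔ b,
    by simpa only [Set.mem_ofPred_eq, compl_sup] using hF.1.inf_mem ha hb, le_sup_left,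
    le_sup_right⟩
  round a ha := by
    obtain ⟨-, b, hb, hba⟩ := hF.2.superset ha
    refine ⟨bᶜ, ?_, ?_⟩
    · rwa [Set.mem_ofPred_eq, compl_compl]
    · simpa only [compl_compl] using P.compl_rel_compl hba

theorem mem_ofConcordant {hF : IsConcordantFilter P.rel F} : a ∈ ofConcordant hF ↔ aᶜ ∈ F :=
  Iff.rfl

theorem ofConcordant_ne_top (hF : IsConcordantFilter P.rel F) : ofConcordant hF ≠ ⊤ := by
  rw [Ne, eq_top_iff_top_mem, mem_ofConcordant, compl_top]
  exact hF.1.2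

theorem codisjoint_ofConcordant {hF : IsConcordantFilter P.rel F} {I : RoundIdeal P} :
    Codisjoint I (ofConcordant hF) ↔ ∃ a ∈ I, a ∈ F := by
  simp only [codisjoint_iff, mem_ofConcordant, compl_compl]

theorem isProperFilter_compl_mem {I : RoundIdeal P} (hI : I ≠ ⊤) :
    IsProperFilter {a | aᶜ ∈ I} := by
  refine .of_inf_mem ?_ (fun a ha b hb => ?_) (fun a b hab => I.lower (compl_le_compl hab)) ?_
  · rw [Set.mem_ofPred_eq, compl_top]
    exact I.bot_mem
  · rw [Set.mem_ofPred_eq, compl_inf]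
    exact Order.Ideal.sup_mem ha hb
  · rwa [Set.mem_ofPred_eq, compl_bot, ← eq_top_iff_top_mem]

theorem roundPart_compl_mem (I : RoundIdeal P) :
    roundPart P.rel {a | aᶜ ∈ I} = {a | aᶜ ∈ I} := by
  refine Set.Subset.antisymm (fun a ha => ha.1) fun a ha => ⟨ha, ?_⟩
  obtain ⟨b, hb, hab⟩ := I.round _ ha
  refine ⟨bᶜ, ?_, ?_⟩
  · rwa [Set.mem_ofPred_eq, compl_compl]
  · simpa only [compl_compl] using P.compl_rel_compl hab

end RoundIdeal

namespace IsDVSpace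

variable {X : Type*} [TopologicalSpace X] {x y : X}

/-- The proximity `≪` on the regular open subsets of a de Vries space. -/
def proximity (h : IsDVSpace X) : Proximity (RO X) where
  rel := RO.WellBelow
  bot_rel_bot := closure_empty.trans_subset (Set.empty_subset _)
  le_of_rel := RO.WellBelow.le (h.orderRegular _)
  rel_mono := RO.WellBelow.mono
  sup_rel := RO.WellBelow.sup
  compl_rel_compl := RO.WellBelow.compl (h.orderRegular _)
  exists_rel_rel := RO.WellBelow.exists_between h.orderNormal

theorem exists_regularOpen_subset (h : IsDVSpace X) {U : Set X} (hU : IsOpen U) (hx : x ∈ U) :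
    ∃ V ∈ RO.nhd x, V.toSet ⊆ U := by
  obtain ⟨V, hV, hxV, hVU⟩ := Opens.isBasis_iff_nbhd.1 h.basis (U := ⟨U, hU⟩) hx
  exact ⟨⟨V, hV⟩, hxV, hVU⟩

theorem eq_of_nhd_eq (h : IsDVSpace X) (hxy : RO.nhd x = RO.nhd y) : x = y := by
  have := h.t0
  refine h.basis.eq_iff.2 ?_
  rintro _ ⟨U, hU, rfl⟩
  exact Set.ext_iff.1 hxy ⟨U, hU⟩

/-- The point of the upper Vietoris space that corresponds to `x`: the round ideal of the regular
open sets whose complement in the Boolean algebra `RO X` contains `x`. -/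
def toUpperVietoris (h : IsDVSpace X) (x : X) : UpperVietoris (RoundIdeal h.proximity) :=
  ⟨.ofConcordant (h.concordant x), RoundIdeal.ofConcordant_ne_top _⟩

theorem mem_toUpperVietoris {h : IsDVSpace X} {U : RO X} :
    U ∈ (h.toUpperVietoris x).1 ↔ Uᶜ ∈ RO.nhd x := Iff.rfl

theorem toUpperVietoris_mem_box {h : IsDVSpace X} {I : RoundIdeal h.proximity} :
    h.toUpperVietoris x ∈ UpperVietoris.box I ↔ ∃ U ∈ I, x ∈ U.toSet :=
  codisjoint_iff.symm.trans (RoundIdeal.codisjoint_ofConcordant (hF := h.concordant x))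

theorem toUpperVietoris_injective (h : IsDVSpace X) : Function.Injective h.toUpperVietoris := by
  refine fun x y hxy => h.eq_of_nhd_eq (Set.ext fun U => ?_)
  have hU : Uᶜ ∈ (h.toUpperVietoris x).1 ↔ Uᶜ ∈ (h.toUpperVietoris y).1 := by rw [hxy]
  simpa only [mem_toUpperVietoris, compl_compl] using hU

theorem toUpperVietoris_surjective (h : IsDVSpace X) : Function.Surjective h.toUpperVietoris := by
  rintro ⟨I, hI⟩
  obtain ⟨x, hx⟩ := h.realized _ (RoundIdeal.isProperFilter_compl_mem hI)
  have hI : RO.nhd x = {U | Uᶜ ∈ I} := hx.symm.trans I.roundPart_compl_mem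
  refine ⟨x, Subtype.ext (SetLike.ext fun U => ?_)⟩
  simp only [mem_toUpperVietoris, hI, Set.mem_ofPred_eq, compl_compl]

theorem toUpperVietoris_preimage_box (h : IsDVSpace X) (I : RoundIdeal h.proximity) :
    h.toUpperVietoris ⁻¹' UpperVietoris.box I = ⋃ U ∈ I, U.toSet := by
  ext x
  simp only [Set.mem_preimage, toUpperVietoris_mem_box, Set.mem_iUnion, exists_prop]

theorem isTopologicalBasis_preimage_box (h : IsDVSpace X) :
    IsTopologicalBasis (Set.range fun I => h.toUpperVietoris ⁻¹' UpperVietoris.box I) := by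
  refine isTopologicalBasis_of_isOpen_of_nhds ?_ fun x U hx hU => ?_
  · rintro _ ⟨I, rfl⟩
    simp only [toUpperVietoris_preimage_box]
    exact isOpen_biUnion fun U _ => U.isOpen_toSet
  · obtain ⟨V, hxV, hVU⟩ := h.exists_regularOpen_subset hU hx
    obtain ⟨W, hxW, hWV⟩ := RO.isConcordantFilter_nhd_iff.1 (h.concordant x) V hxV
    refine ⟨_, ⟨.below h.proximity V, rfl⟩, ?_⟩
    simp only [toUpperVietoris_preimage_box]
    have hle {U : RO X} (hU : U ∈ RoundIdeal.below h.proximity V) : U.toSet ⊆ V.toSet :=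
      RO.le_iff.1 (h.proximity.le_of_rel (RoundIdeal.mem_below.1 hU))
    exact ⟨Set.mem_biUnion (x := W) (RoundIdeal.mem_below.2 hWV) hxW,
      Set.iUnion₂_subset fun U hU => (hle hU).trans hVU⟩

theorem isInducing_toUpperVietoris (h : IsDVSpace X) : Topology.IsInducing h.toUpperVietoris := by
  refine ⟨h.isTopologicalBasis_preimage_box.eq_generateFrom.trans ?_⟩
  rw [UpperVietoris.instTopologicalSpace, induced_generateFrom_eq, ← Set.range_comp]
  rfl

/-- A de Vries space is the upper Vietoris space of its frame of round ideals. -/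
noncomputable def homeomorph (h : IsDVSpace X) : X ≃ₜ UpperVietoris (RoundIdeal h.proximity) :=
  (Equiv.ofBijective _ ⟨h.toUpperVietoris_injective,
    h.toUpperVietoris_surjective⟩).toHomeomorphOfIsInducing h.isInducing_toUpperVietoris

end IsDVSpace

section Frames

variable {L : Type*} [Order.Frame L]

/-- The pseudo-complements of the elements of a filter form a directed set, so compactness applies
to their join. -/
theorem codisjoint_iSup_compl_iff (hc : IsCompactFrame L) {F : Set (Heyting.Regular L)}
    (hF : IsProperFilter F) {a : L} :
    Codisjoint a (⨆ b ∈ F, (b : L)ᶜ) ↔ ∃ b ∈ F, RatherBelow (b : L) a := by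
  simp only [ratherBelow_iff_codisjoint]
  refine ⟨fun h => ?_, fun ⟨b, hb, hab⟩ => hab.mono_right (le_iSup₂_of_le b hb le_rfl)⟩
  have hdir : DirectedOn (· ≤ ·) ((fun b : Heyting.Regular L => (b : L)ᶜ) '' F) := by
    rintro _ ⟨b, hb, rfl⟩ _ ⟨d, hd, rfl⟩
    exact ⟨_, ⟨b ⊓ d, hF.inf_mem hb hd, rfl⟩, compl_le_compl inf_le_left,
      compl_le_compl inf_le_right⟩
  rw [← sSup_image] at h
  obtain ⟨_, ⟨b, hb, rfl⟩, hba⟩ :=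
    hc.exists_codisjoint_of_sSup (Set.Nonempty.image _ ⟨⊤, hF.top_mem⟩) hdir h.symm
  exact ⟨b, hb, hba.symm⟩

end Frames

namespace UpperVietoris

variable {L : Type*} [Order.Frame L] {a b : L} {c d : UpperVietoris L}

theorem mem_box : c ∈ box a ↔ Codisjoint a c.1 := codisjoint_iff.symm

theorem isOpen_box (a : L) : IsOpen (box a) := isOpen_generateFrom_of_mem ⟨a, rfl⟩

theorem box_mono (h : a ≤ b) : box a ⊆ box b :=
  fun _ hc => mem_box.2 ((mem_box.1 hc).mono_left h)

theorem box_inf (a b : L) : box (a ⊓ b) = box a ∩ box b := by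
  ext c
  simp only [Set.mem_inter_iff, mem_box, codisjoint_inf_left]

theorem box_top : box (⊤ : L) = Set.univ :=
  Set.eq_univ_of_forall fun _ => mem_box.2 codisjoint_top_left

theorem box_bot : box (⊥ : L) = ∅ :=
  Set.eq_empty_of_forall_notMem fun c hc => c.2 (bot_codisjoint.1 (mem_box.1 hc))

theorem isTopologicalBasis_box : IsTopologicalBasis (Set.range (box (L := L))) := by
  refine isTopologicalBasis_of_subbasis_of_finiteInter rfl ⟨⟨⊤, box_top⟩, ?_⟩
  rintro _ ⟨a, rfl⟩ _ ⟨b, rfl⟩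
  exact ⟨a ⊓ b, box_inf a b⟩

theorem exists_box_subset {U : Set (UpperVietoris L)} (hU : IsOpen U) (hc : c ∈ U) :
    ∃ a, c ∈ box a ∧ box a ⊆ U := by
  obtain ⟨_, ⟨a, rfl⟩, h⟩ := isTopologicalBasis_box.exists_subset_of_mem_open hc hU
  exact ⟨a, h⟩

theorem specLE_of_le (h : c.1 ≤ d.1) : SpecLE c d := by
  intro U hU hc
  obtain ⟨a, ha, haU⟩ := exists_box_subset hU hc
  exact haU (mem_box.2 ((mem_box.1 ha).mono_right h))

theorem compactSpace : CompactSpace (UpperVietoris L) := by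
  obtain _ | ⟨⟨c⟩⟩ := isEmpty_or_nonempty (UpperVietoris L)
  · infer_instance
  let bot : UpperVietoris L := ⟨⊥, ne_top_of_le_ne_top c.2 bot_le⟩
  refine ⟨isCompact_of_finite_subcover fun U hU hcov => ?_⟩
  obtain ⟨i, hi⟩ := Set.mem_iUnion.1 (hcov (Set.mem_univ bot))
  exact ⟨{i}, fun d _ => Set.mem_biUnion (Finset.mem_singleton_self i)
    (specLE_of_le bot_le (U i) (hU i) hi)⟩

variable (hr : IsRegularFrame L)

section

include hr

theorem specLE_iff_le : SpecLE c d ↔ c.1 ≤ d.1 := by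
  refine ⟨fun h => hr.le_of_forall_ratherBelow_le fun b hb => ?_, specLE_of_le⟩
  have hb : c ∈ box bᶜ := mem_box.2 (ratherBelow_iff_codisjoint.1 hb).symm
  have hd : Codisjoint bᶜ d.1 := mem_box.1 (h _ (isOpen_box bᶜ) hb)
  exact disjoint_compl_right.le_of_codisjoint hd

theorem t0Space : T0Space (UpperVietoris L) := by
  refine ⟨fun c d h => Subtype.ext (le_antisymm ?_ ?_)⟩
  · exact (specLE_iff_le hr).1 (specLE_iff_specializes.2 h.specializes')
  · exact (specLE_iff_le hr).1 (specLE_iff_specializes.2 h.specializes)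

theorem mem_downSet_box : c ∈ downSet (box a) ↔ ¬a ≤ c.1 := by
  constructor
  · rintro ⟨d, hd, hcd⟩ hac
    have had : a ≤ d.1 := hac.trans ((specLE_iff_le hr).1 hcd)
    exact d.2 ((sup_eq_right.2 had).symm.trans hd)
  · intro h
    obtain ⟨b, hb, hbc⟩ : ∃ b, RatherBelow b a ∧ ¬b ≤ c.1 := by
      by_contra! hle
      exact h (hr.le_of_forall_ratherBelow_le hle)
    have hne : bᶜ ⊔ c.1 ≠ ⊤ := fun h =>
      hbc (disjoint_compl_right.le_of_codisjoint (codisjoint_iff.2 h))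
    have hd : (⟨bᶜ ⊔ c.1, hne⟩ : UpperVietoris L) ∈ box a :=
      mem_box.2 ((ratherBelow_iff_codisjoint.1 hb).mono_right le_sup_left)
    exact ⟨_, hd, specLE_of_le le_sup_right⟩

theorem box_subset_box_iff : box a ⊆ box b ↔ a ≤ b := by
  refine ⟨fun h => ?_, box_mono⟩
  by_contra hab
  have hne : b ≠ ⊤ := fun hb => hab (hb ▸ le_top)
  have hb : (⟨b, hne⟩ : UpperVietoris L) ∈ downSet (box a) := (mem_downSet_box hr).2 hab
  exact (mem_downSet_box hr).1 (downSet_mono h hb) le_rfl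

theorem isOrderRegularOpen_box (a : L) : IsOrderRegularOpen (box a) := by
  refine Set.Subset.antisymm (fun c hc => ?_)
    (subset_upInterior_of_isOpen (isOpen_box a) (subset_downSet _))
  by_contra hac
  exact (mem_downSet_box hr).1 (hc ⟨a ⊔ c.1, hac⟩ (specLE_of_le le_sup_right)) le_sup_left

end

/-- The basic open set `□ a` as an element of the frame of open sets. -/
def openBox (a : L) : Opens (UpperVietoris L) := ⟨box a, isOpen_box a⟩

section

include hr

theorem disjoint_openBox_iff : Disjoint (openBox a) (openBox b) ↔ Disjoint a b := by
  have h : openBox a ⊓ openBox b ≤ ⊥ ↔ box (a ⊓ b) ⊆ box ⊥ := by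
    rw [box_inf, box_bot]
    rfl
  rw [disjoint_iff_inf_le, disjoint_iff_inf_le, h, box_subset_box_iff hr]

theorem compl_eq_openBox (U : Opens (UpperVietoris L)) :
    Uᶜ = openBox (sSup {a | openBox a ≤ U})ᶜ := by
  apply le_antisymm
  · intro c hc
    obtain ⟨b, hcb, hb⟩ := exists_box_subset (Uᶜ).isOpen hc
    refine box_mono ?_ hcb
    rw [le_compl_iff_disjoint_right, disjoint_sSup_iff]
    intro a ha
    rw [← disjoint_openBox_iff hr]
    exact disjoint_compl_left.mono (show openBox b ≤ Uᶜ from hb) ha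
  · rw [le_compl_iff_disjoint_right, disjoint_iff_inf_le]
    rintro c ⟨hc, hcU⟩
    obtain ⟨a, hca, ha⟩ := exists_box_subset U.isOpen hcU
    have hdisj : Disjoint (openBox (sSup {a | openBox a ≤ U})ᶜ) (openBox a) :=
      (disjoint_openBox_iff hr).2 (disjoint_compl_left.mono_right (le_sSup ha))
    exact hdisj.le_bot ⟨hc, hca⟩

theorem compl_openBox (a : L) : (openBox a)ᶜ = openBox aᶜ := by
  have h : {b | openBox b ≤ openBox a} = Set.Iic a := Set.ext fun b => box_subset_box_iff hr
  rw [compl_eq_openBox hr, h, csSup_Iic]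

theorem isRegular_openBox (ha : Heyting.IsRegular a) : Heyting.IsRegular (openBox a) := by
  rw [Heyting.IsRegular, compl_openBox hr, compl_openBox hr, ha.eq]

theorem exists_openBox_eq (U : RO (UpperVietoris L)) :
    ∃ a : Heyting.Regular L, openBox (a : L) = U := by
  have h := compl_eq_openBox hr (U : Opens (UpperVietoris L))ᶜ
  rw [U.prop.eq] at h
  exact ⟨⟨_, Heyting.isRegular_compl _⟩, h.symm⟩

theorem closure_box (a : L) : closure (box a) = (box aᶜ)ᶜ := by
  have h : box aᶜ = (closure (box a))ᶜ :=
    (congrArg SetLike.coe (compl_openBox hr a)).symm.trans (coe_compl_opens (openBox a))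
  rw [h, compl_compl]

theorem closure_box_subset_downSet_box_iff :
    closure (box a) ⊆ downSet (box b) ↔ RatherBelow a b := by
  rw [closure_box hr, ratherBelow_iff_codisjoint]
  constructor
  · intro h
    by_contra hab
    have hne : b ≠ ⊤ := fun hb => hab (hb ▸ codisjoint_top_left)
    have hb : (⟨b, hne⟩ : UpperVietoris L) ∈ (box aᶜ)ᶜ := fun hb => hab (mem_box.1 hb).symm
    exact (mem_downSet_box hr).1 (h hb) le_rfl
  · exact fun hab c hc => (mem_downSet_box hr).2 fun hbc => hc (mem_box.2 (hab.mono_left hbc).symm)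

end

/-- The isomorphism `□` from the regular elements of a regular frame to the regular open subsets of
its upper Vietoris space. -/
noncomputable def regularBox : Heyting.Regular L ≃o RO (UpperVietoris L) :=
  RelIso.ofSurjective
    (OrderEmbedding.ofMapLEIff
      (fun a : Heyting.Regular L =>
        (⟨openBox (a : L), isRegular_openBox hr a.prop⟩ : RO (UpperVietoris L)))
      fun _ _ => box_subset_box_iff hr)
    fun U => (exists_openBox_eq hr U).imp fun _ h => Heyting.Regular.coe_injective h

theorem toSet_regularBox (a : Heyting.Regular L) : (regularBox hr a).toSet = box (a : L) := rfl

theorem wellBelow_regularBox_iff (a b : Heyting.Regular L) :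
    (regularBox hr a).WellBelow (regularBox hr b) ↔ RatherBelow (a : L) b :=
  closure_box_subset_downSet_box_iff hr

include hr

theorem isOrderRegularOpen (U : RO (UpperVietoris L)) : IsOrderRegularOpen U.toSet := by
  obtain ⟨a, rfl⟩ := (regularBox hr).surjective U
  exact isOrderRegularOpen_box hr a

variable (hc : IsCompactFrame L)

include hc

theorem exists_regular_ratherBelow (h : c ∈ box a) :
    ∃ b : Heyting.Regular L, RatherBelow (b : L) a ∧ c ∈ box (b : L) := by
  obtain ⟨b, hba, hbc⟩ := exists_ratherBelow_codisjoint hc hr (mem_box.1 h)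
  exact ⟨⟨bᶜᶜ, Heyting.isRegular_compl _⟩, hba.compl_compl,
    mem_box.2 (hbc.mono_left le_compl_compl)⟩

theorem isBasis_isRegular :
    Opens.IsBasis {U : Opens (UpperVietoris L) | Heyting.IsRegular U} := by
  refine Opens.isBasis_iff_nbhd.2 fun {U c} hcU => ?_
  obtain ⟨a, hca, ha⟩ := exists_box_subset U.isOpen hcU
  obtain ⟨b, hba, hcb⟩ := exists_regular_ratherBelow hr hc hca
  exact ⟨openBox b, isRegular_openBox hr b.prop, hcb, (box_mono hba.le).trans ha⟩

theorem exists_subset_downSet_box_compl {A : Set (UpperVietoris L)} (hA : IsClosed A)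
    (h : A ⊆ downSet (box a)) : ∃ b, A ⊆ downSet (box bᶜ) ∧ (downSet (box a))ᶜ ⊆ box b := by
  obtain rfl | ha := eq_or_ne a ⊤
  · refine ⟨⊥, by rwa [compl_bot], fun c hc => (hc ?_).elim⟩
    exact subset_downSet _ (mem_box.2 codisjoint_top_left)
  have haA : (⟨a, ha⟩ : UpperVietoris L) ∉ A := fun haA => (mem_downSet_box hr).1 (h haA) le_rfl
  obtain ⟨d, had, hdA⟩ := exists_box_subset hA.isOpen_compl haA
  obtain ⟨b, hbd, hba⟩ := exists_ratherBelow_codisjoint hc hr (mem_box.1 had)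
  refine ⟨b, fun c hcA => (mem_downSet_box hr).2 fun hbc => ?_, fun c hca => ?_⟩
  · exact hdA (mem_box.2 ((ratherBelow_iff_codisjoint.1 hbd).mono_right hbc)) hcA
  · rw [Set.mem_compl_iff, mem_downSet_box hr, not_not] at hca
    exact mem_box.2 (hba.mono_right hca)

theorem isOrderNormal : IsOrderNormal (UpperVietoris L) := by
  intro A B hA hB hAB
  obtain ⟨U, rfl⟩ := RO.isRegularClosed_iff.1 hB
  obtain ⟨a, rfl⟩ := (regularBox hr).surjective U
  rw [upInterior_compl, toSet_regularBox] at hAB ⊢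
  obtain ⟨b, hAb, hba⟩ :=
    exists_subset_downSet_box_compl hr hc hA (Set.disjoint_compl_right_iff_subset.1 hAB)
  refine ⟨box bᶜ, box b, isOpen_box _, isOpen_box _, ?_, hAb, hba⟩
  rw [Set.disjoint_iff_inter_eq_empty, ← box_inf, compl_inf_self, box_bot]

theorem isConcordantFilter_nhd (c : UpperVietoris L) :
    IsConcordantFilter RO.WellBelow (RO.nhd c) := by
  refine RO.isConcordantFilter_nhd_iff.2 fun U hU => ?_
  obtain ⟨a, rfl⟩ := (regularBox hr).surjective U
  obtain ⟨b, hba, hcb⟩ := exists_regular_ratherBelow hr hc hU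
  exact ⟨regularBox hr b, hcb, (wellBelow_regularBox_iff hr b a).2 hba⟩

theorem exists_roundPart_eq_nhd {F : Set (RO (UpperVietoris L))} (hF : IsProperFilter F) :
    ∃ c, roundPart RO.WellBelow F = RO.nhd c := by
  have hG : IsProperFilter (regularBox hr ⁻¹' F) := hF.preimage (regularBox hr)
  have hmem {a : L} := codisjoint_iSup_compl_iff hc hG (a := a)
  have hne : (⨆ b ∈ regularBox hr ⁻¹' F, (b : L)ᶜ) ≠ ⊤ := fun h => by
    obtain ⟨b, hb, hbot⟩ := (hmem (a := ⊥)).1 (bot_codisjoint.2 h)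
    have hb' : b = ⊥ := le_bot_iff.1 (Heyting.Regular.coe_le_coe.1 hbot.le)
    exact hG.2 (hb' ▸ hb)
  refine ⟨⟨_, hne⟩, (regularBox hr).surjective.preimage_injective ?_⟩
  rw [← roundPart_preimage (regularBox hr) (wellBelow_regularBox_iff hr)]
  ext a
  refine Iff.trans ?_ (mem_box.trans hmem).symm
  exact and_iff_right_of_imp fun ⟨b, hb, hba⟩ =>
    hG.mem_of_le (Heyting.Regular.coe_le_coe.1 hba.le) hb

theorem isDVSpace : IsDVSpace (UpperVietoris L) where
  t0 := t0Space hr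
  compact := compactSpace
  orderNormal := isOrderNormal hr hc
  basis := isBasis_isRegular hr hc
  orderRegular := isOrderRegularOpen hr
  concordant := isConcordantFilter_nhd hr hc
  realized _ := exists_roundPart_eq_nhd hr hc

end UpperVietoris

section Homeomorphism

variable {X Y : Type*} [TopologicalSpace X] [TopologicalSpace Y] (e : X ≃ₜ Y)

theorem preimage_downSet (U : Set Y) : e ⁻¹' downSet U = downSet (e ⁻¹' U) := by
  ext x
  simp only [downSet, specLE_iff_specializes, Set.mem_preimage, Set.mem_ofPred_eq,
    e.surjective.exists, e.isInducing.specializes_iff]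

theorem preimage_upInterior (U : Set Y) : e ⁻¹' upInterior U = upInterior (e ⁻¹' U) := by
  ext x
  simp only [upInterior, specLE_iff_specializes, Set.mem_preimage, Set.mem_ofPred_eq,
    e.surjective.forall, e.isInducing.specializes_iff]

/-- The isomorphism between the algebras of regular open sets given by taking preimages. -/
def RO.comap : RO Y ≃o RO X where
  toFun U := ⟨e.symm.opensCongr U, by
    rw [Heyting.IsRegular, ← map_compl, ← map_compl, U.prop.eq]⟩
  invFun U := ⟨e.opensCongr U, by rw [Heyting.IsRegular, ← map_compl, ← map_compl, U.prop.eq]⟩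
  left_inv U := Heyting.Regular.coe_injective (e.symm.opensCongr.symm_apply_apply _)
  right_inv U := Heyting.Regular.coe_injective (e.symm.opensCongr.apply_symm_apply _)
  map_rel_iff' := e.symm.opensCongr.le_iff_le

theorem RO.toSet_comap (U : RO Y) : (RO.comap e U).toSet = e ⁻¹' U.toSet := rfl

theorem RO.wellBelow_comap_iff (U V : RO Y) :
    (RO.comap e U).WellBelow (RO.comap e V) ↔ U.WellBelow V := by
  rw [WellBelow, toSet_comap, toSet_comap, ← preimage_downSet, ← e.preimage_closure,
    e.surjective.preimage_subset_preimage_iff, WellBelow]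

include e

theorem IsOrderNormal.of_homeomorph (h : IsOrderNormal Y) : IsOrderNormal X := by
  intro A B hA hB hAB
  obtain ⟨A, rfl⟩ := e.injective.preimage_surjective A
  obtain ⟨B, rfl⟩ := e.injective.preimage_surjective B
  rw [IsRegularClosed, ← e.preimage_interior, ← e.preimage_closure] at hB
  rw [← preimage_upInterior, Set.disjoint_preimage_iff e.surjective] at hAB
  obtain ⟨U, V, hU, hV, hUV, hAU, hBV⟩ :=
    h A B (e.isClosed_preimage.1 hA) (e.surjective.preimage_injective hB) hAB
  refine ⟨e ⁻¹' U, e ⁻¹' V, hU.preimage e.continuous, hV.preimage e.continuous, hUV.preimage e,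
    ?_, ?_⟩
  · exact preimage_downSet e U ▸ Set.preimage_mono hAU
  · exact preimage_upInterior e B ▸ Set.preimage_mono hBV

theorem IsDVSpace.of_homeomorph (h : IsDVSpace Y) : IsDVSpace X where
  t0 := have := h.t0; e.isEmbedding.t0Space
  compact := have := h.compact; e.symm.compactSpace
  orderNormal := h.orderNormal.of_homeomorph e
  basis := Opens.isBasis_iff_nbhd.2 fun {U x} hx => by
    obtain ⟨V, hxV, hVU⟩ := h.exists_regularOpen_subset (e.isOpen_image.2 U.isOpen)
      (Set.mem_image_of_mem e hx)
    exact ⟨RO.comap e V, (RO.comap e V).prop, hxV,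
      (Set.preimage_mono hVU).trans (e.injective.preimage_image _).subset⟩
  orderRegular U := by
    obtain ⟨U, rfl⟩ := (RO.comap e).surjective U
    rw [IsOrderRegularOpen, RO.toSet_comap, ← preimage_downSet, ← preimage_upInterior,
      h.orderRegular U]
  concordant x := RO.isConcordantFilter_nhd_iff.2 fun U hU => by
    obtain ⟨U, rfl⟩ := (RO.comap e).surjective U
    obtain ⟨V, hV, hVU⟩ := RO.isConcordantFilter_nhd_iff.1 (h.concordant (e x)) U hU
    exact ⟨RO.comap e V, hV, (RO.wellBelow_comap_iff e V U).2 hVU⟩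
  realized F hF := by
    obtain ⟨y, hy⟩ := h.realized _ (hF.preimage (RO.comap e))
    obtain ⟨x, rfl⟩ := e.surjective y
    refine ⟨x, (RO.comap e).surjective.preimage_injective ?_⟩
    rw [← roundPart_preimage (RO.comap e) (RO.wellBelow_comap_iff e), hy]
    rfl

end Homeomorphism

theorem theorem6p5 (X : Type u) [TopologicalSpace X] :
    IsDVSpace X ↔
      ∃ (L : Type u) (_ : Order.Frame L),
        IsCompactFrame L ∧ IsRegularFrame L ∧ Nonempty (X ≃ₜ UpperVietoris L) := by
  constructor
  · intro h
    exact ⟨RoundIdeal h.proximity, inferInstance, RoundIdeal.isCompactFrame,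
      RoundIdeal.isRegularFrame, ⟨h.homeomorph⟩⟩
  · rintro ⟨L, _, hc, hr, ⟨e⟩⟩
    exact (UpperVietoris.isDVSpace hr hc).of_homeomorph e
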